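/- Let $\Sigma$ be a finite alphabet with a default symbol $\Box\in\Sigma$, and write $\log n=\lceil\log_2 n\rceil$. **Models.** A window $w\in\Sigma^*$ is changed by the operations $\mathsf{rightpush}(a)$, $\mathsf{leftpush}(a)$ ($a\in\Sigma$), $\mathsf{leftpop}$, $\mathsf{rightpop}$ (pops leave $\varepsilon$ unchanged), and $\mathsf{query}$ asks whether $w\in L$. The one-way models $\mathsf{1F},\mathsf{1V}$ only have $\mathsf{rightpush}$, $\mathsf{leftpop}$ and $\mathsf{query}$; the two-way models $\mathsf{2F},\mathsf{2V}$ have all operations. In the fixed-size models $\mathsf{1F},\mathsf{2F}$ the window is initially $\Box^n$ and each push is directly followed by a pop on the other side. In the variable-size models $\mathsf{1V},\mathsf{2V}$ the window is initially $\varepsilon$ and the operations come in any order, subject to the window length never exceeding $n$. **Algorithms.** A non-uniform $M$-algorithm $\mathcal A=(\mathcal A_n)_{n\ge0}$ with word size $b(n)$ for $L$ consists, for each $n$, of registers of at most $b(n)$ bits with fixed initial contents and of one decision tree for each operation of $M$, whose inner nodes read a register (with one child per possible value) or write a constant to a register; the leaves of the query tree are labelled with bits. In every computation of $M$ for (maximal)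 window size $n$, $\mathcal A_n$ has to answer all queries correctly. Its latency $T^{\mathcal A}(n)$ is the maximal height (number of register accesses on a branch) of its trees. **Classes.** $\mathsf{Len}$: regular languages that contain, for each $n$, all or none of the words of length $n$. $\mathsf{LI}$: languages $\Sigma^*K$ with $K$ regular. $\mathsf{Fin}$: finite languages. $\langle\cdot\rangle$ denotes the Boolean closure of the union of the given classes. We say that $L$ *splits* length $n$ if $\emptyset\ne L\cap\Sigma^n\ne\Sigma^n$. **Theorem.** Let $L\subseteq\Sigma^*$ be regular. - (a) If $M\in\{\mathsf{1F},\mathsf{1V}\}$ and $L\notin\langle\mathsf{Len},\mathsf{LI}\rangle$, then there is a constant $C$ such that every non-uniform $M$-algorithm $\mathcal A$ for $L$ with word size $1$ satisfies $T^{\mathcal A}(n)\ge\log n-C$ for infinitely many $n$. - (b) $\mathsf{Len}=\langle\mathsf{Len}\rangle$. If $L\notin\mathsf{Len}$, then there is a constant $C$ such that every non-uniform $\mathsf{2V}$-algorithm $\mathcal A$ for $L$ with word size $1$ satisfies $T^{\mathcal A}(n)\ge\log n-C$ for all $n$. - (c) If $L\notin\langle\mathsf{Len},\mathsf{Fin}\rangle$,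 then $L$ splits infinitely many lengths, and there is a constant $C$ such that every non-uniform $\mathsf{2F}$-algorithm $\mathcal A$ for $L$ with word size $1$ satisfies $T^{\mathcal A}(n)\ge\log n-C$ for all $n$ such that $L$ splits length $n$, and hence for infinitely many $n$. Moreover, in each of these cases constant latency requires word size $\Omega(\log n)$: for every $T$ there is a constant $c>0$ such that every non-uniform $M$-algorithm for $L$ with word size $b(n)$ and latency at most $T$ for all $n$ satisfies $b(n)\ge c\log n$ for infinitely many $n$ if $M=\mathsf{1F}$ in (a); for all $n\ge N$ if $M=\mathsf{1V}$ in (a) and in case (b); and for all $n\ge N$ such that $L$ splits length $n$ (infinitely many) in case (c). Here $N$ does not depend on the algorithm. -/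

import Mathlib

namespace SlidingWindow

/-- The four sliding window models: one-way / two-way, fixed-size / variable-size. -/
inductive Model
  | oneF
  | oneV
  | twoF
  | twoV

/-- The two-way models. -/
def Model.TwoWay : Model → Prop
  | .oneF => False
  | .oneV => False
  | .twoF => True
  | .twoV => True

/-- The operations over the alphabet `α` that belong to the model `M`. -/
inductive Op (M : Model) (α : Type*)
  | rightpush (a : α)
  | leftpop
  | query
  | leftpush (h : M.TwoWay) (a : α)
  | rightpop (h : M.TwoWay)

theorem Op.finite (M : Model) (α : Type*) [Finite α] : Finite (Op M α) := by
  classical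
  let f : Op M α → (α ⊕ α) ⊕ Fin 3 := fun op => match op with
    | .rightpush a => .inl (.inl a)
    | .leftpop => .inr 0
    | .query => .inr 1
    | .leftpush _ a => .inl (.inr a)
    | .rightpop _ => .inr 2
  refine Finite.of_injective f ?_
  intro x y h
  cases x <;> cases y <;> simp_all [f]

noncomputable instance Op.instFintype (M : Model) (α : Type*) [Finite α] : Fintype (Op M α) :=
  @Fintype.ofFinite _ (Op.finite M α)

/-- The effect of one operation on the window. -/
def Op.apply {M : Model} {α : Type*} : Op M α → List α → List α
  | .rightpush a, w => w ++ [a]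
  | .leftpop, w => w.tail
  | .query, w => w
  | .leftpush _ a, w => a :: w
  | .rightpop _, w => w.dropLast

/-- The window content after the operations `s`, starting from the window `w`. -/
def windowAfter {M : Model} {α : Type*} (w : List α) (s : List (Op M α)) : List α :=
  s.foldl (fun w op => op.apply w) w

/-- The initial window: `blank` repeated `n` times in the fixed-size models, empty in the
variable-size models. -/
def initialWindow {α : Type*} (M : Model) (blank : α) (n : ℕ) : List α :=
  match M with
  | .oneF => List.replicate n blank
  | .twoF => List.replicate n blank
  | .oneV => []
  | .twoV => []

/-- Operation sequences of the fixed-size models: every push is directly followed by a pop on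
the other side. -/
inductive FixedSeq {M : Model} {α : Type*} : List (Op M α) → Prop
  | nil : FixedSeq []
  | query {s : List (Op M α)} : FixedSeq s → FixedSeq (.query :: s)
  | right (a : α) {s : List (Op M α)} :
      FixedSeq s → FixedSeq (.rightpush a :: .leftpop :: s)
  | left (h : M.TwoWay) (a : α) {s : List (Op M α)} :
      FixedSeq s → FixedSeq (.leftpush h a :: .rightpop h :: s)

/-- Operation sequences of the variable-size models, from the empty window, along which the
window never gets longer than `n`. -/
def VariableSeq {M : Model} {α : Type*} (n : ℕ) (s : List (Op M α)) : Prop :=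
  ∀ p : List (Op M α), p <+: s → (windowAfter [] p).length ≤ n

/-- The operation sequences of the model `M` for window size `n` (fixed-size models), respectively
maximal window size `n` (variable-size models). -/
def IsComputation {α : Type*} (M : Model) (n : ℕ) (s : List (Op M α)) : Prop :=
  match M with
  | .oneF => FixedSeq s
  | .twoF => FixedSeq s
  | .oneV => VariableSeq n s
  | .twoV => VariableSeq n s

/-- The contents of a register of `k` bits. -/
abbrev Word (k : ℕ) : Type := Fin k → Bool

/-- Memory contents, when register `i` has `width i` bits. -/
abbrev Memory (width : ℕ → ℕ) : Type := (i : ℕ) → Word (width i)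

/-- Decision trees over registers of the given sizes, with leaves labelled by elements of `O`. -/
inductive DecisionTree (width : ℕ → ℕ) (O : Type)
  | leaf (o : O)
  | read (i : ℕ) (next : Word (width i) → DecisionTree width O)
  | write (i : ℕ) (u : Word (width i)) (next : DecisionTree width O)

namespace DecisionTree

variable {width : ℕ → ℕ} {O : Type}

/-- The maximal number of register accesses on a branch. -/
def height : DecisionTree width O → ℕ
  | leaf _ => 0
  | read _ next => (Finset.univ.sup fun v => (next v).height) + 1
  | write _ _ next => next.height + 1

/-- Execution of a decision tree on a memory: the label of the leaf that is reached and the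
resulting memory. -/
def run : DecisionTree width O → Memory width → O × Memory width
  | leaf o, m => (o, m)
  | read i next, m => (next (m i)).run m
  | write i u next, m => next.run (Function.update m i u)

end DecisionTree

/-- What an operation returns: a bit for a query, nothing otherwise. -/
def Op.Output {M : Model} {α : Type*} : Op M α → Type
  | .query => Bool
  | .rightpush _ => Unit
  | .leftpop => Unit
  | .leftpush _ _ => Unit
  | .rightpop _ => Unit

/-- A cell probe algorithm with word size `b` for one (maximal) window size: registers of at most
`b` bits, their contents after the preprocessing phase, and a decision tree for each operation of
the model. -/
structure CellProbeAlgorithm (M : Model) (α : Type*) (b : ℕ) where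
  width : ℕ → ℕ
  width_le : ∀ i, width i ≤ b
  init : Memory width
  tree : (op : Op M α) → DecisionTree width op.Output

namespace CellProbeAlgorithm

variable {M : Model} {α : Type*} {b : ℕ}

/-- The memory after the operations `s`, starting from the memory `m`. -/
def memoryAfter (A : CellProbeAlgorithm M α b) (m : Memory A.width) (s : List (Op M α)) :
    Memory A.width :=
  s.foldl (fun m op => ((A.tree op).run m).2) m

/-- The answer of a query made after the operations `s`, from the initial memory. -/
def answer (A : CellProbeAlgorithm M α b) (s : List (Op M α)) : Bool :=
  ((A.tree .query).run (A.memoryAfter A.init s)).1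

/-- The algorithm solves the sliding window problem for `L` and (maximal) window size `n`:
each query is answered according to whether the current window belongs to `L`. -/
def Solves (A : CellProbeAlgorithm M α b) (blank : α) (L : Language α) (n : ℕ) : Prop :=
  ∀ s : List (Op M α), IsComputation M n s →
    (A.answer s = true ↔ windowAfter (initialWindow M blank n) s ∈ L)

/-- The latency: the maximal height of a decision tree. -/
noncomputable def latency [Finite α] (A : CellProbeAlgorithm M α b) : ℕ :=
  Finset.univ.sup fun op : Op M α => (A.tree op).height

end CellProbeAlgorithm

/-- A non-uniform `M`-algorithm with word size function `b`: one cell probe algorithm for every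
(maximal) window size `n`. -/
abbrev NonuniformAlgorithm (M : Model) (α : Type*) (b : ℕ → ℕ) : Type _ :=
  (n : ℕ) → CellProbeAlgorithm M α (b n)

/-- A non-uniform algorithm for the sliding window problem of the language `L`. -/
def NonuniformAlgorithm.IsFor {M : Model} {α : Type*} {b : ℕ → ℕ}
    (A : NonuniformAlgorithm M α b) (blank : α) (L : Language α) : Prop :=
  ∀ n, (A n).Solves blank L n

/-- The regular length languages: regular, and containing all or none of the words of each
length. -/
def Len (α : Type*) : Set (Language α) :=
  {L | L.IsRegular ∧
    ∀ n : ℕ, (∀ w : List α, w.length = n → w ∈ L) ∨ (∀ w : List α, w.length = n → w ∉ L)}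

/-- The regular left ideals, i.e. the languages of the form `Σ* K` with `K` regular. -/
def LI (α : Type*) : Set (Language α) :=
  {L | ∃ K : Language α, K.IsRegular ∧ L = ⊤ * K}

/-- The finite languages. -/
def FinLang (α : Type*) : Set (Language α) :=
  {L | Set.Finite {w : List α | w ∈ L}}

/-- The Boolean closure of a class of languages: closure under union, intersection and
complement in `Σ*`. -/
def BoolClosure {α : Type*} (S : Set (Language α)) : Set (Language α) :=
  {L | L ∈ BooleanSubalgebra.closure S}

/-- `L` contains some, but not all, of the words of length `n`. -/
def SplitsLength {α : Type*} (L : Language α) (n : ℕ) : Prop :=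
  (∃ u : List α, u.length = n ∧ u ∈ L) ∧ (∃ v : List α, v.length = n ∧ v ∉ L)

end SlidingWindow

open SlidingWindow

open SlidingWindow

/-!
Every lower bound comes from counting memory contents. The decision trees of an algorithm with
word size `b` and latency `T` mention at most `∑ j < T, 2 ^ (b * j)` registers per operation, so its
memory has at most `b` times that many bits, up to a constant factor. On the other hand, the models
can store `m` bits in the window, with `m` linear in the window size `n`, and later recover any one
of them by a single query (`EncodesBits`); hence the memory needs at least `m` bits
(`EncodesBits.le`). For `b = 1` this yields `n ≤ O(2 ^ T)`, for constant `T` it yields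
`n ≤ 2 ^ O(b + 1)` (`exists_clog_sub_le_latency`, `exists_mul_clog_le_wordSize`).

In the two-way models the stored bits are letters. If `L` splits length `k`, there are words
`x a y ∈ L` and `x b y ∉ L` of length `k`, and any letter of the window can be isolated by operations
at both ends and then surrounded by `x` and `y` (`SplitsLength.encodesBits_twoF`,
`SplitsLength.encodesBits_twoV`).

In the one-way models the stored bits are words of a code (`BitCode`), which is found in an
automaton that reads the window from right to left. If from some reachable state `p` there are two
words `z₁`, `z₂` of the same length such that `p` can be reached again after either of them, but only
`z₁` leads to acceptance, then they can be extended to loops at `p` of the same length, which are the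
code words. If there is no such state, count lengths modulo a common multiple `D` of loop lengths:
whether a word belongs to `L` then depends only on its length modulo `D` and on the strongly
connected component of the product automaton in which its run ends. The words
whose run ends in a state reachable from a given one form a left ideal, and these left ideals
determine the component; so `L` is a Boolean combination of left ideals and length languages
(`nonempty_bitCode`).
-/

namespace SlidingWindow

/-! ### Counting memory contents -/

namespace DecisionTree

variable {width : ℕ → ℕ} {O : Type}

/-- The registers that occur in a decision tree. -/
def registers : DecisionTree width O → Finset ℕ
  | leaf _ => ∅
  | read i next => insert i (Finset.univ.biUnion fun v => (next v).registers)
  | write i _ next => insert i next.registers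

theorem card_registers_le {b : ℕ} (hw : ∀ i, width i ≤ b) (t : DecisionTree width O) :
    t.registers.card ≤ ∑ j ∈ Finset.range t.height, (2 ^ b) ^ j := by
  have mono : ∀ {h k : ℕ}, h ≤ k →
      ∑ j ∈ Finset.range h, (2 ^ b) ^ j ≤ ∑ j ∈ Finset.range k, (2 ^ b) ^ j := fun h =>
    Finset.sum_le_sum_of_subset (Finset.range_mono h)
  induction t with
  | leaf o => simp [registers]
  | write i u next ih =>
    rw [registers, height, geom_sum_succ]
    refine (Finset.card_insert_le _ _).trans (Nat.add_le_add_right (ih.trans ?_) 1)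
    exact Nat.le_mul_of_pos_left _ (by positivity)
  | read i next ih =>
    rw [registers, height, geom_sum_succ]
    refine (Finset.card_insert_le _ _).trans (Nat.add_le_add_right ?_ 1)
    refine (Finset.card_biUnion_le_card_mul _ _ _ fun v _ => (ih v).trans (mono
      (Finset.le_sup (f := fun v => (next v).height) (Finset.mem_univ v)))).trans ?_
    refine Nat.mul_le_mul_right _ ?_
    simpa using Nat.pow_le_pow_right two_pos (hw i)

theorem run_snd_apply_of_notMem (t : DecisionTree width O) (m : Memory width) {i : ℕ}
    (hi : i ∉ t.registers) : (t.run m).2 i = m i := by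
  induction t generalizing m with
  | leaf o => rfl
  | write j u next ih =>
    simp only [registers, Finset.mem_insert, not_or] at hi
    rw [run, ih _ hi.2, Function.update_of_ne hi.1]
  | read j next ih =>
    simp only [registers, Finset.mem_insert, Finset.mem_biUnion, Finset.mem_univ, true_and,
      not_or, not_exists] at hi
    rw [run, ih _ _ (hi.2 _)]

end DecisionTree

namespace CellProbeAlgorithm

variable {M : Model} {α : Type*} {b : ℕ}

theorem memoryAfter_append (A : CellProbeAlgorithm M α b) (m : Memory A.width)
    (s t : List (Op M α)) :
    A.memoryAfter m (s ++ t) = A.memoryAfter (A.memoryAfter m s) t := by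
  simp [memoryAfter]

/-- The registers that occur in the decision trees of an algorithm. -/
noncomputable def registers [Finite α] (A : CellProbeAlgorithm M α b) : Finset ℕ :=
  Finset.univ.biUnion fun op : Op M α => (A.tree op).registers

theorem card_registers_le [Finite α] (A : CellProbeAlgorithm M α b) :
    A.registers.card ≤
      Fintype.card (Op M α) * ∑ j ∈ Finset.range A.latency, (2 ^ b) ^ j := by
  refine Finset.card_biUnion_le_card_mul _ _ _ fun op _ =>
    ((A.tree op).card_registers_le A.width_le).trans ?_
  exact Finset.sum_le_sum_of_subset (Finset.range_mono
    (Finset.le_sup (f := fun op : Op M α => (A.tree op).height) (Finset.mem_univ op)))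

theorem memoryAfter_apply_of_notMem [Finite α] (A : CellProbeAlgorithm M α b)
    (m : Memory A.width) (s : List (Op M α)) {i : ℕ} (hi : i ∉ A.registers) :
    A.memoryAfter m s i = m i := by
  induction s generalizing m with
  | nil => rfl
  | cons op s ih =>
    refine (ih _).trans ((A.tree op).run_snd_apply_of_notMem m fun h => hi ?_)
    exact Finset.mem_biUnion.2 ⟨op, Finset.mem_univ _, h⟩

end CellProbeAlgorithm

/-- For (maximal) window size `n`, the model can store any `m` bits in the window in such a way
that each of them can later be recovered by a single query to `L`: `store` writes a list of `m`
bits, and `probe i` prepares the window for a query for the `i`-th bit. -/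
def EncodesBits {α : Type*} (M : Model) (blank : α) (L : Language α) (n m : ℕ) : Prop :=
  ∃ (store : List Bool → List (Op M α)) (probe : ℕ → List (Op M α)),
    ∀ (s t : List Bool) (e : Bool), s.length + 1 + t.length = m →
      IsComputation M n (store (s ++ e :: t) ++ probe s.length) ∧
      (windowAfter (initialWindow M blank n) (store (s ++ e :: t) ++ probe s.length) ∈ L ↔
        e = true)

/-- The memory after `store β` determines all bits of `β`, so there are at least `2 ^ m` memory
contents; they differ only in the registers that occur in the decision trees. -/
theorem EncodesBits.le {α : Type*} [Finite α] {M : Model} {blank : α} {L : Language α}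
    {n m b : ℕ} (h : EncodesBits M blank L n m) (A : CellProbeAlgorithm M α b)
    (hA : A.Solves blank L n) :
    m ≤ b * (Fintype.card (Op M α) * ∑ j ∈ Finset.range A.latency, (2 ^ b) ^ j) := by
  obtain ⟨store, probe, h⟩ := h
  have answer_eq : ∀ (β : List Bool) (hβ : β.length = m) (i : ℕ) (hi : i < β.length),
      A.answer (store β ++ probe i) = β[i] := by
    intro β hβ i hi
    have hsplit : β = β.take i ++ β[i] :: β.drop (i + 1) := by simp
    have hlen : (β.take i).length = i := by simp; omega
    obtain ⟨hc, hL⟩ := h (β.take i) (β.drop (i + 1)) β[i] (by simp; omega)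
    rw [← hsplit, hlen] at hc hL
    exact Bool.eq_iff_iff.2 ((hA _ hc).trans hL)
  let f : List.Vector Bool m → ((i : A.registers) → Word (A.width i)) :=
    fun β i => A.memoryAfter A.init (store β.1) i
  have hf : Function.Injective f := by
    intro β γ hβγ
    have hmem : A.memoryAfter A.init (store β.1) = A.memoryAfter A.init (store γ.1) := by
      funext i
      by_cases hi : i ∈ A.registers
      · exact congrFun hβγ ⟨i, hi⟩
      · rw [A.memoryAfter_apply_of_notMem _ _ hi, A.memoryAfter_apply_of_notMem _ _ hi]
    refine Subtype.ext (List.ext_getElem (β.2.trans γ.2.symm) fun i h₁ h₂ => ?_)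
    rw [← answer_eq _ β.2 i h₁, ← answer_eq _ γ.2 i h₂, CellProbeAlgorithm.answer,
      CellProbeAlgorithm.answer, A.memoryAfter_append, A.memoryAfter_append, hmem]
  have hcard := Fintype.card_le_of_injective f hf
  simp only [card_vector, Fintype.card_bool, Fintype.card_pi, Fintype.card_fin,
    Finset.prod_const, Finset.card_univ] at hcard
  have hprod : ∏ i : A.registers, 2 ^ A.width i ≤ 2 ^ (b * A.registers.card) := by
    rw [Finset.prod_pow_eq_pow_sum]
    refine Nat.pow_le_pow_right two_pos ((Finset.sum_le_card_nsmul _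
      (fun i : A.registers => A.width i) b fun i _ => A.width_le i).trans ?_)
    simp [mul_comm]
  exact ((Nat.pow_le_pow_iff_right one_lt_two).1 (hcard.trans hprod)).trans
    (Nat.mul_le_mul_left _ A.card_registers_le)

/-- With one-bit registers, latency `T` allows fewer than `2 ^ T` registers per operation. -/
theorem exists_clog_sub_le_latency {α : Type*} [Finite α] (M : Model) (blank : α)
    (L : Language α) (c d : ℕ) :
    ∃ C : ℕ, ∀ (n m : ℕ) (A : CellProbeAlgorithm M α 1), EncodesBits M blank L n m →
      n ≤ c * m + d → A.Solves blank L n → (Nat.clog 2 n : ℤ) - C ≤ A.latency := by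
  set K := Fintype.card (Op M α)
  refine ⟨c * K + d, fun n m A h hn hA => ?_⟩
  have hm := h.le A hA
  have hgeom : ∑ j ∈ Finset.range A.latency, (2 ^ 1) ^ j ≤ 2 ^ A.latency := by
    simpa using (Nat.geomSum_lt (m := 2) (s := Finset.range A.latency) le_rfl
      (fun k hk => Finset.mem_range.1 hk)).le
  have hpos : 1 ≤ 2 ^ A.latency := Nat.one_le_two_pow
  have : n ≤ 2 ^ (c * K + d + A.latency) := calc
    n ≤ c * (K * 2 ^ A.latency) + d * 2 ^ A.latency := by
      refine hn.trans (Nat.add_le_add (Nat.mul_le_mul_left _ (hm.trans ?_))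
        (Nat.le_mul_of_pos_right _ hpos))
      rw [one_mul]
      exact Nat.mul_le_mul_left _ hgeom
    _ = (c * K + d) * 2 ^ A.latency := by ring
    _ ≤ 2 ^ (c * K + d) * 2 ^ A.latency := Nat.mul_le_mul_right _ Nat.lt_two_pow_self.le
    _ = _ := (pow_add _ _ _).symm
  have := Nat.clog_le_of_le_pow this
  lia

/-- With `b`-bit registers, latency `T` allows at most `T * 2 ^ (b * T)` registers per
operation. -/
theorem exists_mul_clog_le_wordSize {α : Type*} [Finite α] (M : Model) (blank : α)
    (L : Language α) (c d T : ℕ) :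
    ∃ ε : ℝ, 0 < ε ∧ ∃ N : ℕ, ∀ (b n m : ℕ) (A : CellProbeAlgorithm M α b),
      EncodesBits M blank L n m → n ≤ c * m + d → A.Solves blank L n → A.latency ≤ T →
        N ≤ n → ε * (Nat.clog 2 n : ℝ) ≤ b := by
  set K := Fintype.card (Op M α)
  set C := c * K * T + d with hC
  -- From `2 ^ (2 * C)` on, the additive constant `C` is at most half of the logarithm.
  refine ⟨1 / (2 * (T + 1)), by positivity, 2 ^ (2 * C), fun b n m A h hn hA hT hN => ?_⟩
  have hm := h.le A hA
  have hgeom : ∑ j ∈ Finset.range A.latency, (2 ^ b) ^ j ≤ T * 2 ^ (b * T) := by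
    refine (Finset.sum_le_card_nsmul _ _ (2 ^ (b * T)) fun j hj => ?_).trans ?_
    · rw [← pow_mul]
      have := Finset.mem_range.1 hj
      exact Nat.pow_le_pow_right two_pos (Nat.mul_le_mul_left _ (by lia))
    · simpa using hT
  have : n ≤ 2 ^ (C + b * (T + 1)) := calc
    n ≤ c * (2 ^ b * (K * (T * 2 ^ (b * T)))) + d * (2 ^ b * 2 ^ (b * T)) := by
      refine hn.trans (Nat.add_le_add (Nat.mul_le_mul_left _ (hm.trans ?_))
        (Nat.le_mul_of_pos_right _ (by positivity)))
      exact Nat.mul_le_mul Nat.lt_two_pow_self.le (Nat.mul_le_mul_left _ hgeom)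
    _ = C * 2 ^ (b * (T + 1)) := by rw [mul_add b, mul_one, pow_add, hC]; ring
    _ ≤ 2 ^ C * 2 ^ (b * (T + 1)) := Nat.mul_le_mul_right _ Nat.lt_two_pow_self.le
    _ = _ := (pow_add _ _ _).symm
  have hupper := Nat.clog_le_of_le_pow this
  have hlower : 2 * C ≤ Nat.clog 2 n := by
    simpa [Nat.clog_pow] using Nat.clog_mono_right 2 hN
  have hfin : Nat.clog 2 n ≤ 2 * (b * (T + 1)) := by lia
  rw [div_mul_eq_mul_div, one_mul, div_le_iff₀ (by positivity)]
  have : (Nat.clog 2 n : ℝ) ≤ 2 * (b * (T + 1)) := by exact_mod_cast hfin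
  linarith

/-! ### Sequences of operations -/

section Operations

variable {M : Model} {α : Type*}

theorem windowAfter_append (w : List α) (s t : List (Op M α)) :
    windowAfter w (s ++ t) = windowAfter (windowAfter w s) t := by
  simp [windowAfter]

theorem windowAfter_map_rightpush (w x : List α) :
    windowAfter w (x.map (Op.rightpush (M := M))) = w ++ x := by
  induction x generalizing w with
  | nil => simp [windowAfter]
  | cons a x ih => exact (ih (w ++ [a])).trans (by simp)

theorem windowAfter_map_leftpush (h : M.TwoWay) (w x : List α) :
    windowAfter w (x.reverse.map (Op.leftpush h)) = x ++ w := by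
  induction x generalizing w with
  | nil => rfl
  | cons a x ih =>
    rw [List.reverse_cons, List.map_append, windowAfter_append, ih]
    rfl

theorem windowAfter_replicate_leftpop (w : List α) (k : ℕ) :
    windowAfter w (List.replicate k (Op.leftpop (M := M))) = w.drop k := by
  induction k generalizing w with
  | zero => rfl
  | succ k ih => exact (ih w.tail).trans (by simp [List.drop_tail])

theorem windowAfter_replicate_rightpop (h : M.TwoWay) (w x : List α) :
    windowAfter (w ++ x) (List.replicate x.length (Op.rightpop h)) = w := by
  induction x using List.reverseRecOn with
  | nil => simp [windowAfter]
  | append_singleton x a ih =>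
    rw [List.length_append, List.length_singleton, List.replicate_succ]
    refine Eq.trans ?_ ih
    change windowAfter (w ++ (x ++ [a])).dropLast _ = _
    rw [← List.append_assoc, List.dropLast_concat]

/-- Push the letters of a word on the right, each push being followed by a pop on the left. -/
def shiftRight (x : List α) : List (Op M α) :=
  x.flatMap fun a => [.rightpush a, .leftpop]

/-- Push the letters of a word on the left, starting with its last letter, each push being
followed by a pop on the right. -/
def shiftLeft (h : M.TwoWay) (x : List α) : List (Op M α) :=
  x.reverse.flatMap fun a => [.leftpush h a, .rightpop h]

theorem windowAfter_shiftRight (w x : List α) :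
    windowAfter w (shiftRight (M := M) x) = (w ++ x).drop x.length := by
  induction x generalizing w with
  | nil => simp [windowAfter, shiftRight]
  | cons a x ih =>
    refine (ih (w ++ [a]).tail).trans ?_
    cases w <;> simp

theorem windowAfter_shiftLeft (h : M.TwoWay) (w x : List α) :
    windowAfter w (shiftLeft h x) = (x ++ w).take w.length := by
  induction x generalizing w with
  | nil => simp [windowAfter, shiftLeft]
  | cons a x ih =>
    rw [shiftLeft, List.reverse_cons, List.flatMap_append, windowAfter_append]
    rw [shiftLeft] at ih
    rw [ih]
    change (a :: (x ++ w).take w.length).dropLast = _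
    rw [List.dropLast_eq_take]
    have hlen : min w.length (x.length + w.length) = w.length := by lia
    cases hw : w.length with
    | zero => simp
    | succ k => simp [← hw]; simp [hw, List.take_take]

theorem shiftRight_append (x y : List α) :
    shiftRight (M := M) (x ++ y) = shiftRight x ++ shiftRight y :=
  List.flatMap_append

theorem FixedSeq.append {s t : List (Op M α)} (hs : FixedSeq s) (ht : FixedSeq t) :
    FixedSeq (s ++ t) := by
  induction hs with
  | nil => exact ht
  | query _ ih => exact ih.query
  | right a _ ih => exact ih.right a
  | left h a _ ih => exact ih.left h a

theorem fixedSeq_shiftRight (x : List α) : FixedSeq (shiftRight (M := M) x) := by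
  induction x with
  | nil => exact .nil
  | cons a x ih => exact ih.right a

theorem fixedSeq_shiftLeft (h : M.TwoWay) (x : List α) : FixedSeq (shiftLeft h x) := by
  rw [shiftLeft]
  induction x.reverse with
  | nil => exact .nil
  | cons a x ih => exact ih.left h a

/-- Whether an operation is a push. -/
def Op.isPush : Op M α → Bool
  | .rightpush _ => true
  | .leftpush _ _ => true
  | .leftpop => false
  | .rightpop _ => false
  | .query => false

theorem length_windowAfter_le (w : List α) (s : List (Op M α)) :
    (windowAfter w s).length ≤ w.length + s.countP Op.isPush := by
  induction s generalizing w with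
  | nil => simp [windowAfter]
  | cons op s ih =>
    refine (ih (op.apply w)).trans ?_
    rw [List.countP_cons]
    cases op <;> simp [Op.apply, Op.isPush] <;> lia

theorem variableSeq_of_countP_le {n : ℕ} {s : List (Op M α)} (h : s.countP Op.isPush ≤ n) :
    VariableSeq n s := fun p hp =>
  (length_windowAfter_le [] p).trans (by simpa using (hp.sublist.countP_le).trans h)

end Operations

/-! ### Storing bits in the window of a two-way model -/

section TwoWay

variable {α : Type*} {blank : α} {L : Language α}

theorem exists_letters_of_length_eq {P : List α → Prop} {u v : List α}
    (h : u.length = v.length) (hu : P u) (hv : ¬ P v) :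
    ∃ x a b y, x.length + 1 + y.length = u.length ∧ P (x ++ a :: y) ∧ ¬ P (x ++ b :: y) := by
  induction u generalizing v P with
  | nil => cases v with
    | nil => exact absurd hu hv
    | cons b v => simp at h
  | cons a u ih => cases v with
    | nil => simp at h
    | cons b v =>
      by_cases hb : P (b :: u)
      · obtain ⟨x, c, d, y, hl, h₁, h₂⟩ := ih (P := fun z => P (b :: z)) (by simpa using h) hb hv
        exact ⟨b :: x, c, d, y, by simp; lia, h₁, h₂⟩
      · exact ⟨[], a, b, u, by simp; lia, hu, hb⟩

/-- If `L` splits length `n`, then for some position its membership depends on the letter at that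
position, in a suitable context. -/
theorem SplitsLength.exists_context {n : ℕ} (h : SplitsLength L n) :
    ∃ (x y : List α) (c : Bool → α), x.length + 1 + y.length = n ∧
      ∀ e, x ++ c e :: y ∈ L ↔ e = true := by
  obtain ⟨⟨u, rfl, hu⟩, v, hv, hv'⟩ := h
  obtain ⟨x, a, b, y, hl, ha, hb⟩ := exists_letters_of_length_eq (P := (· ∈ L)) hv.symm hu hv'
  refine ⟨x, y, fun e => cond e a b, hl, fun e => ?_⟩
  cases e <;> simp [ha, hb]

/-- The letters to the right of the requested one are shifted out of the window on the right; then
that letter is shifted to the left end, so that the letters before it leave the window as well; now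
the context can be completed. -/
theorem SplitsLength.encodesBits_twoF {n : ℕ} (h : SplitsLength L n) :
    EncodesBits Model.twoF blank L n n := by
  obtain ⟨x, y, c, hn, hc⟩ := h.exists_context
  have two : Model.twoF.TwoWay := trivial
  refine ⟨fun β => shiftRight (β.map c), fun i =>
    shiftLeft two (List.replicate (n - 1 - i) blank) ++
      (shiftRight (y ++ List.replicate x.length blank) ++ shiftLeft two x),
    fun s t e hst => ⟨(fixedSeq_shiftRight _).append ((fixedSeq_shiftLeft _ _).append
      ((fixedSeq_shiftRight _).append (fixedSeq_shiftLeft _ _))), ?_⟩⟩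
  have hi : n - 1 - s.length = t.length := by lia
  have h₁ : windowAfter (List.replicate n blank)
      (shiftRight (M := .twoF) ((s ++ e :: t).map c)) = (s ++ e :: t).map c := by
    rw [windowAfter_shiftRight]
    exact List.drop_left' (by simp; lia)
  have h₂ : windowAfter ((s ++ e :: t).map c)
      (shiftLeft two (List.replicate t.length blank)) =
        (List.replicate t.length blank ++ s.map c) ++ [c e] := by
    have : List.replicate t.length blank ++ (s ++ e :: t).map c =
        ((List.replicate t.length blank ++ s.map c) ++ [c e]) ++ t.map c := by simp
    rw [windowAfter_shiftLeft, this]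
    exact List.take_left' (by simp; lia)
  have h₃ : windowAfter ((List.replicate t.length blank ++ s.map c) ++ [c e])
      (shiftRight (M := .twoF) (y ++ List.replicate x.length blank)) =
        c e :: (y ++ List.replicate x.length blank) := by
    rw [windowAfter_shiftRight, List.append_assoc]
    exact List.drop_left' (by simp; lia)
  have h₄ : windowAfter (c e :: (y ++ List.replicate x.length blank)) (shiftLeft two x) =
      x ++ c e :: y := by
    rw [windowAfter_shiftLeft, ← List.cons_append, ← List.append_assoc]
    exact List.take_left' (by simp; lia)
  simp only [initialWindow, windowAfter_append]
  rw [h₁, hi, h₂, h₃, h₄]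
  exact hc e

/-- All letters except the requested one are popped; then the context of length `k` is
completed. -/
theorem SplitsLength.encodesBits_twoV {k : ℕ} (h : SplitsLength L k) (n : ℕ) :
    EncodesBits Model.twoV blank L n (n - k) := by
  obtain ⟨x, y, c, hk, hc⟩ := h.exists_context
  have two : Model.twoV.TwoWay := trivial
  refine ⟨fun β => (β.map c).map .rightpush, fun i =>
    List.replicate (n - k - 1 - i) (.rightpop two) ++ (List.replicate i .leftpop ++
      (x.reverse.map (.leftpush two) ++ y.map .rightpush)), fun s t e hst => ⟨?_, ?_⟩⟩
  · refine variableSeq_of_countP_le ?_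
    simp only [List.countP_append, List.countP_map, List.countP_replicate, Op.isPush]
    simp [Function.comp_def, Op.isPush]
    lia
  · have hi : n - k - 1 - s.length = (t.map c).length := by simp; lia
    simp only [initialWindow, windowAfter_append]
    rw [windowAfter_map_rightpush _ y, windowAfter_map_rightpush, List.nil_append, List.map_append,
      List.map_cons, List.append_cons, hi, windowAfter_replicate_rightpop, windowAfter_replicate_leftpop,
      List.drop_left' (by simp), windowAfter_map_leftpush]
    simpa using hc e

end TwoWay

/-! ### Storing bits in the window of a one-way model -/

section OneWay

variable {α : Type*} {blank : α} {L : Language α}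

/-- A family of words over two code words `u' ++ u` and `v' ++ v` of the same length such that,
whatever sequence `β` of code words followed by `w` comes after it, the suffixes `u` and `v` of the
code words are told apart by `L`. -/
structure BitCode (L : Language α) where
  (u u' v v' w : List α)
  length_eq : u.length = v.length
  length_eq' : u'.length = v'.length
  mem_iff : ∀ (e : Bool) (β : List Bool),
    cond e u v ++ (β.flatMap (fun e => cond e (u' ++ u) (v' ++ v)) ++ w) ∈ L ↔ e = true

namespace BitCode

variable (B : BitCode L)

/-- The suffix of the code word of `e` that is relevant for queries. -/
def tail (e : Bool) : List α := cond e B.u B.v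

/-- The part of the code word of `e` before `B.tail e`. -/
def head (e : Bool) : List α := cond e B.u' B.v'

/-- The concatenation of the code words of a sequence of bits. -/
def encode (β : List Bool) : List α := β.flatMap fun e => B.head e ++ B.tail e

/-- The length of the code words. -/
def blockLength : ℕ := B.u'.length + B.u.length

theorem length_tail (e : Bool) : (B.tail e).length = B.u.length := by
  cases e
  · exact B.length_eq.symm
  · rfl

theorem length_head (e : Bool) : (B.head e).length = B.u'.length := by
  cases e
  · exact B.length_eq'.symm
  · rfl

theorem encode_append (β γ : List Bool) : B.encode (β ++ γ) = B.encode β ++ B.encode γ :=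
  List.flatMap_append

theorem encode_cons (e : Bool) (β : List Bool) :
    B.encode (e :: β) = B.head e ++ (B.tail e ++ B.encode β) := by
  simp [encode]

theorem length_encode (β : List Bool) : (B.encode β).length = β.length * B.blockLength := by
  induction β with
  | nil => simp [encode]
  | cons e β ih =>
    simp only [encode_cons, List.length_append, length_head, length_tail, ih, List.length_cons,
      blockLength]
    ring

theorem tail_append_mem_iff (e : Bool) (β : List Bool) :
    B.tail e ++ (B.encode β ++ B.w) ∈ L ↔ e = true := by
  have : B.encode β = β.flatMap (fun e => cond e (B.u' ++ B.u) (B.v' ++ B.v)) := by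
    unfold encode
    congr 1
    funext e
    cases e <;> rfl
  rw [this]
  exact B.mem_iff e β

theorem blockLength_pos : 0 < B.blockLength := by
  by_contra! h
  have hu : B.tail true = [] := List.length_eq_zero_iff.1 (by
    rw [length_tail]; unfold blockLength at h; lia)
  have hv : B.tail false = [] := List.length_eq_zero_iff.1 (by
    rw [length_tail]; unfold blockLength at h; lia)
  have h₁ := B.tail_append_mem_iff true []
  have h₂ := B.tail_append_mem_iff false []
  rw [hu] at h₁
  rw [hv] at h₂
  exact absurd (h₂.1 (h₁.2 rfl)) (by simp)

/-- After `B.w` has been pushed, pops on the left make the window start inside the requested code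
word. -/
theorem encodesBits_oneV (n : ℕ) :
    EncodesBits Model.oneV blank L n ((n - B.w.length) / B.blockLength) := by
  refine ⟨fun β => (B.encode β).map .rightpush, fun i => B.w.map .rightpush ++
    List.replicate (i * B.blockLength + B.u'.length) .leftpop, fun s t e hst => ⟨?_, ?_⟩⟩
  · have hmul : (s.length + 1 + t.length) * B.blockLength ≤ n - B.w.length := by
      rw [hst]
      exact Nat.div_mul_le_self _ _
    have hpos := B.blockLength_pos
    have hlow : B.blockLength ≤ (s.length + 1 + t.length) * B.blockLength :=
      Nat.le_mul_of_pos_left _ (by lia)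
    have hlen := B.length_encode (s ++ e :: t)
    rw [List.length_append, List.length_cons, ← add_assoc, add_right_comm] at hlen
    refine variableSeq_of_countP_le ?_
    simp only [List.countP_append, List.countP_map, List.countP_replicate, Op.isPush]
    simp [Function.comp_def, Op.isPush]
    lia
  · simp only [initialWindow, windowAfter_append]
    rw [windowAfter_map_rightpush, windowAfter_map_rightpush, windowAfter_replicate_leftpop,
      List.nil_append, encode_append, encode_cons]
    have : B.encode s ++ (B.head e ++ (B.tail e ++ B.encode t)) ++ B.w =
        (B.encode s ++ B.head e) ++ (B.tail e ++ (B.encode t ++ B.w)) := by simp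
    rw [this, List.drop_left' (by simp [length_encode, length_head])]
    exact B.tail_append_mem_iff e t

theorem le_oneV (n : ℕ) :
    n ≤ B.blockLength * ((n - B.w.length) / B.blockLength) + (B.blockLength + B.w.length) := by
  have h₁ := Nat.div_add_mod (n - B.w.length) B.blockLength
  have h₂ := Nat.mod_lt (n - B.w.length) B.blockLength_pos
  lia

/-- Further code words and `B.w` are pushed until the window starts inside the requested code
word. -/
theorem encodesBits_oneF (m : ℕ) :
    EncodesBits Model.oneF blank L (B.u.length + m * B.blockLength + B.w.length) (m + 1) := by
  refine ⟨fun β => shiftRight (B.encode β), fun i =>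
    shiftRight (B.encode (List.replicate i true) ++ B.w), fun s t e hst =>
      ⟨(fixedSeq_shiftRight _).append (fixedSeq_shiftRight _), ?_⟩⟩
  set n := B.u.length + m * B.blockLength + B.w.length
  have hm : m = t.length + s.length := by lia
  set r := List.replicate s.length true
  have key : windowAfter (List.replicate n blank) (shiftRight (M := .oneF)
      (B.encode (s ++ e :: t)) ++ shiftRight (B.encode r ++ B.w)) =
        B.tail e ++ (B.encode (t ++ r) ++ B.w) := by
    rw [← shiftRight_append, windowAfter_shiftRight]
    have : List.replicate n blank ++ (B.encode (s ++ e :: t) ++ (B.encode r ++ B.w)) =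
        (List.replicate n blank ++ B.encode s ++ B.head e) ++
          (B.tail e ++ (B.encode (t ++ r) ++ B.w)) := by
      simp [encode_append, encode_cons]
    rw [this]
    refine List.drop_left' ?_
    simp only [List.length_append, List.length_cons, List.length_replicate, length_encode,
      length_head, n, r, hm]
    simp only [blockLength]
    ring
  rw [initialWindow, key]
  exact B.tail_append_mem_iff e _

theorem frequently_oneF : ∃ᶠ n : ℕ in Filter.atTop, ∃ m, EncodesBits Model.oneF blank L n m ∧
    n ≤ B.blockLength * m + (B.u.length + B.w.length) := by
  refine Filter.frequently_atTop.2 fun k => ⟨_, ?_, k + 1, B.encodesBits_oneF k, ?_⟩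
  · have := Nat.le_mul_of_pos_right k B.blockLength_pos
    lia
  · rw [mul_add, mul_comm k]
    lia

end BitCode

end OneWay

/-! ### Boolean combinations of length languages, left ideals and finite languages -/

section Languages

variable {α : Type*} {L : Language α}

/-- A set whose membership is determined by the memberships in finitely many elements of a
Boolean algebra of sets belongs to that Boolean algebra. -/
theorem mem_of_forall_mem_iff (B : BooleanSubalgebra (Language α)) {ι : Type*} (s : Finset ι)
    (U : ι → Language α) (hU : ∀ i ∈ s, U i ∈ B) (L : Language α)
    (h : ∀ x y, (∀ i ∈ s, x ∈ U i ↔ y ∈ U i) → x ∈ L → y ∈ L) : L ∈ B := by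
  classical
  induction s using Finset.induction_on generalizing L with
  | empty =>
    by_cases hL : ∃ x, x ∈ L
    · obtain ⟨x, hx⟩ := hL
      have : L = ⊤ := eq_top_iff.2 fun y _ => h x y (by simp) hx
      exact this ▸ B.top_mem
    · have : L = ⊥ := eq_bot_iff.2 fun y hy => (hL ⟨y, hy⟩).elim
      exact this ▸ B.bot_mem
  | insert i s _ ih =>
    let V (V₀ : Language α) : Language α :=
      {x | ∃ y ∈ L, y ∈ V₀ ∧ ∀ j ∈ s, y ∈ U j ↔ x ∈ U j}
    have hV (V₀ : Language α) : V V₀ ∈ B :=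
      ih (fun j hj => hU j (Finset.mem_insert_of_mem hj)) _ fun x y hxy ⟨z, hz, hz₀, hzx⟩ =>
        ⟨z, hz, hz₀, fun j hj => (hzx j hj).trans (hxy j hj)⟩
    have hi := hU i (Finset.mem_insert_self i s)
    have : L = (U i ⊓ V (U i)) ⊔ ((U i)ᶜ ⊓ V (U i)ᶜ) := by
      refine le_antisymm (fun x hx => ?_) (fun x hx => ?_)
      · by_cases hxi : x ∈ U i
        · exact Or.inl ⟨hxi, x, hx, hxi, fun _ _ => Iff.rfl⟩
        · exact Or.inr ⟨hxi, x, hx, hxi, fun _ _ => Iff.rfl⟩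
      · rcases hx with ⟨hxi, y, hy, hyi, hyx⟩ | ⟨hxi, y, hy, hyi, hyx⟩ <;>
          refine h y x (fun j hj => ?_) hy <;>
          rcases Finset.mem_insert.1 hj with rfl | hj
        · exact iff_of_true hyi hxi
        · exact hyx j hj
        · exact iff_of_false hyi hxi
        · exact hyx j hj
    rw [this]
    exact B.sup_mem (B.inf_mem hi (hV _)) (B.inf_mem (B.compl_mem hi) (hV _))

theorem len_eq_boolClosure_len : Len α = BoolClosure (Len α) := by
  have hcompl : ∀ K ∈ Len α, Kᶜ ∈ Len α := fun K hK =>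
    ⟨hK.1.compl, fun n => (hK.2 n).symm.imp_right fun h w hw hw' => hw' (h w hw)⟩
  have hsup : ∀ K ∈ Len α, ∀ K' ∈ Len α, K ⊔ K' ∈ Len α := by
    refine fun K hK K' hK' => ⟨hK.1.add hK'.1, fun n => ?_⟩
    rcases hK.2 n with h | h
    · exact .inl fun w hw => Or.inl (h w hw)
    rcases hK'.2 n with h' | h'
    · exact .inl fun w hw => Or.inr (h' w hw)
    · exact .inr fun w hw => not_or.2 ⟨h w hw, h' w hw⟩
  have hbot : (⊥ : Language α) ∈ Len α :=
    ⟨⟨Unit, inferInstance, ⟨fun _ _ => (), (), ∅⟩, rfl⟩, fun n => .inr fun w _ hw => hw⟩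
  let B : BooleanSubalgebra (Language α) :=
    { carrier := Len α
      supClosed' := fun K hK K' hK' => hsup K hK K' hK'
      infClosed' := fun K hK K' hK' => by
        simpa using hcompl _ (hsup _ (hcompl K hK) _ (hcompl K' hK'))
      compl_mem' := fun hK => hcompl _ hK
      bot_mem' := hbot }
  exact Set.Subset.antisymm BooleanSubalgebra.subset_closure
    (BooleanSubalgebra.closure_le (L := B).2 subset_rfl)

theorem exists_splitsLength (hL : L.IsRegular) (h : L ∉ Len α) : ∃ k, SplitsLength L k := by
  by_contra! hs
  refine h ⟨hL, fun n => ?_⟩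
  by_contra! hn
  obtain ⟨⟨v, hv, hv'⟩, u, hu, hu'⟩ := hn
  exact hs n ⟨⟨u, hu, hu'⟩, v, hv, hv'⟩

theorem isRegular_length_lt (N : ℕ) : Language.IsRegular {w : List α | w.length < N} := by
  refine Language.IsRegular.of_finite_range_leftQuotient
    (((Set.finite_Iic N).image fun k => {y : List α | k + y.length < N}).subset ?_)
  rintro _ ⟨x, rfl⟩
  refine ⟨min x.length N, by simp, ?_⟩
  ext y
  change min x.length N + y.length < N ↔ (x ++ y).length < N
  rw [List.length_append]
  lia

/-- If `L` splits only lengths less than `N`, it is the union of a finite language and of a length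
language. -/
theorem frequently_splitsLength [Finite α] (hL : L.IsRegular)
    (h : L ∉ BoolClosure (Len α ∪ FinLang α)) :
    ∃ᶠ n : ℕ in Filter.atTop, SplitsLength L n := by
  rw [Filter.frequently_atTop]
  by_contra! hN
  obtain ⟨N, hN⟩ := hN
  let S : Language α := {w | w.length < N}
  have hS : S.IsRegular := isRegular_length_lt N
  have h₁ : L ⊓ S ∈ FinLang α :=
    (List.finite_length_lt α N).subset fun w hw => hw.2
  have h₂ : L ⊓ Sᶜ ∈ Len α := by
    refine ⟨hL.inf hS.compl, fun n => ?_⟩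
    rcases lt_or_ge n N with hn | hn
    · exact .inr fun w hw hw' => hw'.2 (show w.length < N by lia)
    by_cases hu : ∃ u : List α, u.length = n ∧ u ∈ L
    · refine .inl fun w hw => ⟨?_, fun hw' => ?_⟩
      · by_contra hwL
        exact hN n hn ⟨hu, w, hw, hwL⟩
      · have : w.length < N := hw'
        lia
    · exact .inr fun w hw hw' => hu ⟨w, hw, hw'.1⟩
  refine h ?_
  change L ∈ BooleanSubalgebra.closure (Len α ∪ FinLang α)
  rw [← sup_inf_inf_compl (x := L) (y := S)]
  exact BooleanSubalgebra.sup_mem (BooleanSubalgebra.subset_closure (.inr h₁))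
    (BooleanSubalgebra.subset_closure (.inl h₂))

theorem mem_li_of_append_mem (hL : L.IsRegular) (h : ∀ x, ∀ w ∈ L, x ++ w ∈ L) : L ∈ LI α := by
  refine ⟨L, hL, le_antisymm (fun w hw => ?_) (fun w hw => ?_)⟩
  · exact Language.mem_mul.2 ⟨[], Set.mem_univ _, w, hw, rfl⟩
  · obtain ⟨x, -, y, hy, rfl⟩ := Language.mem_mul.1 hw
    exact h x y hy

theorem isRegular_eval_reverse_length {σ : Type} [Fintype σ] (A : DFA α σ) (D : ℕ) [NeZero D]
    (S : Set (σ × ZMod D)) :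
    Language.IsRegular {w : List α | (A.eval w.reverse, (w.length : ZMod D)) ∈ S} := by
  let A' : DFA α (σ × ZMod D) := ⟨fun q a => (A.step q.1 a, q.2 + 1), (A.start, 0), S⟩
  have heval : ∀ w, A'.eval w = (A.eval w, (w.length : ZMod D)) := by
    intro w
    induction w using List.reverseRecOn with
    | nil => simp [A']
    | append_singleton w a ih => simp [ih, A']
  have : Language.IsRegular A'.accepts := ⟨_, inferInstance, A', rfl⟩
  have heq : A'.accepts.reverse =
      {w : List α | (A.eval w.reverse, (w.length : ZMod D)) ∈ S} := by
    ext w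
    change A'.eval w.reverse ∈ S ↔ _
    rw [heval, List.length_reverse]
    rfl
  exact heq ▸ this.reverse

end Languages

/-! ### Automata that read the window from right to left -/

section ReverseAutomata

variable {α : Type*} {L : Language α} {σ : Type}

theorem evalFrom_flatten_replicate (A : DFA α σ) {p : σ} {x : List α}
    (hx : A.evalFrom p x = p) (k : ℕ) : A.evalFrom p (List.replicate k x).flatten = p := by
  induction k with
  | zero => rfl
  | succ k ih => rw [List.replicate_succ, List.flatten_cons, DFA.evalFrom_of_append, hx, ih]

/-- Two loops `x ++ x'` and `y ++ y'` at the same reachable state such that `x` leads to an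
accepting state, but `y` does not, are the code words of a bit code. -/
theorem nonempty_bitCode_of_loops (A : DFA α σ) (hA : A.accepts = L.reverse) {a x x' y y' : List α}
    (hlen : x.length = y.length) (hlen' : x'.length = y'.length)
    (hx : A.evalFrom (A.eval a) (x ++ x') = A.eval a)
    (hy : A.evalFrom (A.eval a) (y ++ y') = A.eval a)
    (hxF : A.evalFrom (A.eval a) x ∈ A.accept) (hyF : A.evalFrom (A.eval a) y ∉ A.accept) :
    Nonempty (BitCode L) := by
  have hloop : ∀ β : List Bool, A.evalFrom (A.eval a) (β.flatMap fun e =>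
      cond e (x'.reverse ++ x.reverse) (y'.reverse ++ y.reverse)).reverse = A.eval a := by
    intro β
    induction β with
    | nil => rfl
    | cons e β ih =>
      rw [List.flatMap_cons, List.reverse_append, DFA.evalFrom_of_append, ih]
      cases e
      · simpa using hy
      · simpa using hx
  refine ⟨⟨x.reverse, x'.reverse, y.reverse, y'.reverse, a.reverse, by simpa, by simpa,
    fun e β => ?_⟩⟩
  have hL : ∀ w, w ∈ L ↔ A.eval w.reverse ∈ A.accept := fun w => by
    rw [← DFA.mem_accepts, hA, Language.reverse_mem_reverse]
  rw [hL, List.reverse_append, List.reverse_append, List.reverse_reverse, DFA.eval,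
    DFA.evalFrom_of_append, DFA.evalFrom_of_append]
  change A.evalFrom (A.evalFrom (A.eval a) _) _ ∈ _ ↔ _
  rw [hloop]
  cases e
  · simpa using hyF
  · simpa using hxF

/-- Some positive number is a common multiple of lengths of loops, one at each state that lies on
a loop. -/
theorem exists_common_loop_length [Fintype σ] (A : DFA α σ) :
    ∃ D : ℕ, D ≠ 0 ∧ ∀ p x, x ≠ [] → A.evalFrom p x = p →
      ∃ z, z.length ∣ D ∧ A.evalFrom p z = p := by
  have : ∀ p, ∃ n : ℕ, n ≠ 0 ∧ ∀ x, x ≠ [] → A.evalFrom p x = p →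
      ∃ z, z.length = n ∧ A.evalFrom p z = p := by
    intro p
    by_cases h : ∃ x, x ≠ [] ∧ A.evalFrom p x = p
    · obtain ⟨x, hx, hp⟩ := h
      exact ⟨x.length, by simpa using hx, fun _ _ _ => ⟨x, rfl, hp⟩⟩
    · exact ⟨1, one_ne_zero, fun x hx hp => (h ⟨x, hx, hp⟩).elim⟩
  choose n hn hloop using this
  refine ⟨∏ p, n p, Finset.prod_ne_zero_iff.2 fun p _ => hn p, fun p x hx hp => ?_⟩
  obtain ⟨z, hz, hz'⟩ := hloop p x hx hp
  exact ⟨z, hz ▸ Finset.dvd_prod_of_mem n (Finset.mem_univ p), hz'⟩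

/-- If `z` leads from the state `p` to `p'` and `z'` leads back, and the length of `z` is a
multiple of the length of a loop at `p`, then either both states are accepting or none of them, or
there is a bit code: the loop can be repeated to a word `ζ` of the length of `z`, and the words
`ζ ++ z ++ z'` and `z ++ z' ++ ζ` are loops at `p` of the same length. -/
theorem mem_accept_iff_of_loops (A : DFA α σ) (hA : A.accepts = L.reverse)
    (hB : ¬ Nonempty (BitCode L)) {a z z' c : List α} (hc : c.length ∣ z.length)
    (hloop : A.evalFrom (A.eval a) c = A.eval a)
    (hz : A.evalFrom (A.eval a) (z ++ z') = A.eval a) :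
    A.eval a ∈ A.accept ↔ A.evalFrom (A.eval a) z ∈ A.accept := by
  obtain ⟨k, hk⟩ := hc
  set ζ := (List.replicate k c).flatten
  have hζ : A.evalFrom (A.eval a) ζ = A.eval a := evalFrom_flatten_replicate A hloop k
  have hlen : ζ.length = z.length := by simp [ζ, hk, mul_comm]
  have hlen' : (z ++ z').length = (z' ++ ζ).length := by simp [hlen, add_comm]
  have h₁ : A.evalFrom (A.eval a) (ζ ++ (z ++ z')) = A.eval a := by
    rw [DFA.evalFrom_of_append, hζ, hz]
  have h₂ : A.evalFrom (A.eval a) (z ++ (z' ++ ζ)) = A.eval a := by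
    rw [← List.append_assoc, DFA.evalFrom_of_append, hz, hζ]
  constructor <;> intro h <;> by_contra h' <;> refine hB ?_
  · exact nonempty_bitCode_of_loops A hA hlen hlen' h₁ h₂ (hζ.symm ▸ h) h'
  · exact nonempty_bitCode_of_loops A hA hlen.symm hlen'.symm h₂ h₁ h (hζ.symm ▸ h')

/-- Without a bit code, membership of `w` in `L` is determined by its length modulo some `D` and by
the strongly connected component that is reached from the right end of `w` in the automaton that
also counts the length modulo `D`; the words that lead to a state reachable from a given one form a
left ideal. -/
theorem nonempty_bitCode (hL : L.IsRegular) (h : L ∉ BoolClosure (Len α ∪ LI α)) :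
    Nonempty (BitCode L) := by
  by_contra hB
  obtain ⟨σ, _, A, hA⟩ := hL.reverse
  have hLA : ∀ w, w ∈ L ↔ A.eval w.reverse ∈ A.accept := fun w => by
    rw [← DFA.mem_accepts, hA, Language.reverse_mem_reverse]
  obtain ⟨D, hD, hloop⟩ := exists_common_loop_length A
  have : NeZero D := ⟨hD⟩
  let S (q : σ × ZMod D) : Set (σ × ZMod D) :=
    {q' | ∃ z : List α, A.evalFrom q.1 z = q'.1 ∧ q.2 + (z.length : ZMod D) = q'.2}
  let U : (σ × ZMod D) ⊕ ZMod D → Language α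
    | .inl q => {w | (A.eval w.reverse, (w.length : ZMod D)) ∈ S q}
    | .inr r => {w | (w.length : ZMod D) = r}
  refine h (mem_of_forall_mem_iff (BooleanSubalgebra.closure (Len α ∪ LI α)) Finset.univ U ?_ L
    fun x y hxy hx => ?_)
  · rintro (q | r) -
    · refine BooleanSubalgebra.subset_closure (.inr (mem_li_of_append_mem
        (isRegular_eval_reverse_length A D _) ?_))
      rintro v w ⟨z, hz, hz'⟩
      refine ⟨z ++ v.reverse, ?_, ?_⟩
      · rw [DFA.evalFrom_of_append, hz, List.reverse_append, DFA.eval,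
          DFA.evalFrom_of_append]
      · dsimp only at hz' ⊢
        rw [List.length_append, List.length_append, List.length_reverse]
        push_cast
        rw [← hz']
        ring
    · refine BooleanSubalgebra.subset_closure (.inl
        ⟨isRegular_eval_reverse_length A D {q | q.2 = r}, fun n => ?_⟩)
      by_cases hn : (n : ZMod D) = r
      · exact .inl fun w hw => by rw [← hw] at hn; exact hn
      · exact .inr fun w hw => by rw [← hw] at hn; exact hn
  -- The runs on `x` and `y` end in states of the same component: `z` leads from the first to the
  -- second and `z'` leads back.
  · have hrefl : ∀ w : List α, w ∈ U (.inl (A.eval w.reverse, (w.length : ZMod D))) :=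
      fun w => ⟨[], rfl, by simp⟩
    obtain ⟨z, hz, hzl⟩ := (hxy (.inl _) (Finset.mem_univ _)).1 (hrefl x)
    obtain ⟨z', hz', -⟩ := (hxy (.inl _) (Finset.mem_univ _)).2 (hrefl y)
    have hxl : (x.length : ZMod D) = y.length :=
      ((hxy (.inr (x.length : ZMod D)) (Finset.mem_univ _)).1 rfl).symm
    dsimp only at hz hz' hzl
    rw [hLA, ← hz]
    rw [hLA] at hx
    have hDz : D ∣ z.length := by
      rw [← ZMod.natCast_eq_zero_iff]
      rw [← hxl] at hzl
      simpa using hzl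
    have hzz : A.evalFrom (A.eval x.reverse) (z ++ z') = A.eval x.reverse := by
      rw [DFA.evalFrom_of_append, hz, hz']
    rcases eq_or_ne z [] with rfl | hne
    · exact hx
    · obtain ⟨c, hcD, hc⟩ := hloop _ (z ++ z') (by simp [hne]) hzz
      exact (mem_accept_iff_of_loops A hA hB (hcD.trans hDz) hc hzz).1 hx

end ReverseAutomata

end SlidingWindow

/-! ### The lower bounds -/

theorem mainTheorem6 {α : Type*} [Finite α] (blank : α) (L : Language α) (hL : L.IsRegular) :
    -- (a), latency for word size 1
    (∀ M : Model, (M = Model.oneF ∨ M = Model.oneV) → L ∉ BoolClosure (Len α ∪ LI α) →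
      ∃ C : ℕ, ∀ A : NonuniformAlgorithm M α (fun _ => 1), A.IsFor blank L →
        ∃ᶠ n : ℕ in Filter.atTop, (Nat.clog 2 n : ℤ) - C ≤ (A n).latency) ∧
    -- (a), word size for constant latency, one-way fixed-size model
    (L ∉ BoolClosure (Len α ∪ LI α) →
      ∀ T : ℕ, ∃ c : ℝ, 0 < c ∧
        ∀ (b : ℕ → ℕ) (A : NonuniformAlgorithm Model.oneF α b), A.IsFor blank L →
          (∀ n, (A n).latency ≤ T) →
            ∃ᶠ n : ℕ in Filter.atTop, c * (Nat.clog 2 n : ℝ) ≤ (b n : ℝ)) ∧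
    -- (a), word size for constant latency, one-way variable-size model
    (L ∉ BoolClosure (Len α ∪ LI α) →
      ∀ T : ℕ, ∃ c : ℝ, 0 < c ∧ ∃ N : ℕ,
        ∀ (b : ℕ → ℕ) (A : NonuniformAlgorithm Model.oneV α b), A.IsFor blank L →
          (∀ n, (A n).latency ≤ T) →
            ∀ n ≥ N, c * (Nat.clog 2 n : ℝ) ≤ (b n : ℝ)) ∧
    -- the regular length languages are closed under the Boolean operations
    Len α = BoolClosure (Len α) ∧
    -- (b), latency for word size 1
    (L ∉ Len α →
      ∃ C : ℕ, ∀ A : NonuniformAlgorithm Model.twoV α (fun _ => 1), A.IsFor blank L →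
        ∀ n : ℕ, (Nat.clog 2 n : ℤ) - C ≤ (A n).latency) ∧
    -- (b), word size for constant latency
    (L ∉ Len α →
      ∀ T : ℕ, ∃ c : ℝ, 0 < c ∧ ∃ N : ℕ,
        ∀ (b : ℕ → ℕ) (A : NonuniformAlgorithm Model.twoV α b), A.IsFor blank L →
          (∀ n, (A n).latency ≤ T) →
            ∀ n ≥ N, c * (Nat.clog 2 n : ℝ) ≤ (b n : ℝ)) ∧
    -- (c), latency for word size 1
    (L ∉ BoolClosure (Len α ∪ FinLang α) →
      (∃ᶠ n : ℕ in Filter.atTop, SplitsLength L n) ∧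
      ∃ C : ℕ, ∀ A : NonuniformAlgorithm Model.twoF α (fun _ => 1), A.IsFor blank L →
        (∃ᶠ n : ℕ in Filter.atTop, (Nat.clog 2 n : ℤ) - C ≤ (A n).latency) ∧
        ∀ n : ℕ, SplitsLength L n → (Nat.clog 2 n : ℤ) - C ≤ (A n).latency) ∧
    -- (c), word size for constant latency
    (L ∉ BoolClosure (Len α ∪ FinLang α) →
      ∀ T : ℕ, ∃ c : ℝ, 0 < c ∧ ∃ N : ℕ,
        ∀ (b : ℕ → ℕ) (A : NonuniformAlgorithm Model.twoF α b), A.IsFor blank L →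
          (∀ n, (A n).latency ≤ T) →
            (∃ᶠ n : ℕ in Filter.atTop, c * (Nat.clog 2 n : ℝ) ≤ (b n : ℝ)) ∧
            ∀ n ≥ N, SplitsLength L n → c * (Nat.clog 2 n : ℝ) ≤ (b n : ℝ)) := by
  refine ⟨?_, ?_, ?_, len_eq_boolClosure_len, ?_, ?_, ?_, ?_⟩
  · rintro M (rfl | rfl) h
    · obtain ⟨B⟩ := nonempty_bitCode hL h
      obtain ⟨C, hC⟩ := exists_clog_sub_le_latency Model.oneF blank L B.blockLength
        (B.u.length + B.w.length)
      exact ⟨C, fun A hA => B.frequently_oneF.mono fun n ⟨m, hm, hn⟩ =>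
        hC n m (A n) hm hn (hA n)⟩
    · obtain ⟨B⟩ := nonempty_bitCode hL h
      obtain ⟨C, hC⟩ := exists_clog_sub_le_latency Model.oneV blank L B.blockLength
        (B.blockLength + B.w.length)
      exact ⟨C, fun A hA => Filter.Frequently.of_forall fun n =>
        hC n _ (A n) (B.encodesBits_oneV n) (B.le_oneV n) (hA n)⟩
  · intro h T
    obtain ⟨B⟩ := nonempty_bitCode hL h
    obtain ⟨ε, hε, N, hN⟩ := exists_mul_clog_le_wordSize Model.oneF blank L B.blockLength
      (B.u.length + B.w.length) T
    exact ⟨ε, hε, fun b A hA hT => (B.frequently_oneF.and_eventually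
      (Filter.eventually_ge_atTop N)).mono fun n ⟨⟨m, hm, hn⟩, hNn⟩ =>
        hN (b n) n m (A n) hm hn (hA n) (hT n) hNn⟩
  · intro h T
    obtain ⟨B⟩ := nonempty_bitCode hL h
    obtain ⟨ε, hε, N, hN⟩ := exists_mul_clog_le_wordSize Model.oneV blank L B.blockLength
      (B.blockLength + B.w.length) T
    exact ⟨ε, hε, N, fun b A hA hT n hn =>
      hN (b n) n _ (A n) (B.encodesBits_oneV n) (B.le_oneV n) (hA n) (hT n) hn⟩
  · intro h
    obtain ⟨k, hk⟩ := exists_splitsLength hL h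
    obtain ⟨C, hC⟩ := exists_clog_sub_le_latency Model.twoV blank L 1 k
    exact ⟨C, fun A hA n => hC n _ (A n) (hk.encodesBits_twoV n) (by lia) (hA n)⟩
  · intro h T
    obtain ⟨k, hk⟩ := exists_splitsLength hL h
    obtain ⟨ε, hε, N, hN⟩ := exists_mul_clog_le_wordSize Model.twoV blank L 1 k T
    exact ⟨ε, hε, N, fun b A hA hT n hn =>
      hN (b n) n _ (A n) (hk.encodesBits_twoV n) (by lia) (hA n) (hT n) hn⟩
  · intro h
    have hfreq := frequently_splitsLength hL h
    obtain ⟨C, hC⟩ := exists_clog_sub_le_latency Model.twoF blank L 1 0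
    refine ⟨hfreq, C, fun A hA => ?_⟩
    have key : ∀ n, SplitsLength L n → (Nat.clog 2 n : ℤ) - C ≤ (A n).latency := fun n hn =>
      hC n n (A n) hn.encodesBits_twoF (by lia) (hA n)
    exact ⟨hfreq.mono key, key⟩
  · intro h T
    have hfreq := frequently_splitsLength hL h
    obtain ⟨ε, hε, N, hN⟩ := exists_mul_clog_le_wordSize Model.twoF blank L 1 0 T
    refine ⟨ε, hε, N, fun b A hA hT => ?_⟩
    have key : ∀ n ≥ N, SplitsLength L n → ε * (Nat.clog 2 n : ℝ) ≤ (b n : ℝ) := fun n hn hs =>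
      hN (b n) n n (A n) hs.encodesBits_twoF (by lia) (hA n) (hT n) hn
    exact ⟨(hfreq.and_eventually (Filter.eventually_ge_atTop N)).mono fun n hn =>
      key n hn.2 hn.1, key⟩
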